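/- Let $(X,d_X)$ and $(Y,d_Y)$ be complete separable metric spaces with $X$ locally compact, and let $d\in\mathbb{N}$. Let $\mathcal{P}_1(Y)$ be the set of Borel probability measures $\mu$ on $Y$ with $\int_Y d_Y(y_0,y)\,\mu(dy)<\infty$ for some $y_0\in Y$, equipped with the Wasserstein metric $$\mathcal{W}_1(\mu,\nu)=\inf_{\pi\in\mathrm{Cpl}(\mu,\nu)}\int_{Y^2} d_Y(y_1,y_2)\,d\pi(y_1,y_2),$$ where $\mathrm{Cpl}(\mu,\nu)$ is the set of Borel probability measures on $Y^2$ with marginals $\mu$ and $\nu$. Let $C(X,\mathcal{P}_1(Y))$ be the set of continuous maps $X\to\mathcal{P}_1(Y)$, equipped with the topology of uniform convergence on compact sets. For $\sigma\in C(\mathbb{R})$ and $N\ge 1$, let $\mathcal{NN}^{\sigma}_{d,N}$ be the set of feedforward networks $\hat f=W_{J+1}\circ(\sigma\bullet W_J)\circ\cdots\circ(\sigma\bullet W_1):\mathbb{R}^d\to\mathbb{R}^N$ with arbitrarily many hidden layers $J\ge 1$ and arbitrary widths, where the $W_j$ are affine maps between Euclidean spaces and $\sigma\bullet{}$ denotes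 componentwise application of $\sigma$. Let $\operatorname{Softmax}_N(x)=\bigl(e^{x_n}/\sum_{k=1}^N e^{x_k}\bigr)_{n=1}^N$. For $\phi\in C(X,\mathbb{R}^d)$ and a non-empty $\mathcal{D}\subseteq\mathcal{P}_1(Y)$, let $\mathcal{NN}^{\sigma:\star}_{\phi,\mathcal{D}}$ be the set of all $\hat F\in C(X,\mathcal{P}_1(Y))$ that can be written as $$\hat F(x)=\sum_{n=1}^N\bigl(\operatorname{Softmax}_N(\hat f(\phi(x)))\bigr)_n\,\hat\mu_n\qquad(x\in X)$$ for some $N\ge 1$, $\hat f\in\mathcal{NN}^{\sigma}_{d,N}$ and $\hat\mu_1,\dots,\hat\mu_N\in\mathcal{D}$. Suppose that $\mathcal{D}$ is non-empty and dense in $\mathcal{P}_1(Y)$, that $\phi\in C(X,\mathbb{R}^d)$ is injective, and that $\sigma\in C(\mathbb{R})$ satisfies the Kidger–Lyons condition: $\sigma$ is not affine, and there is a point at which $\sigma$ is differentiable with non-zero derivative. Then $\mathcal{NN}^{\sigma:\star}_{\phi,\mathcal{D}}$ is dense in $C(X,\mathcal{P}_1(Y))$. -/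

import Mathlib

open MeasureTheory ProbabilityTheory TopologicalSpace
open scoped ENNReal

noncomputable section

/-! ### The Wasserstein space `𝒫₁(Y)` -/

/-- The set `𝒫₁(Y)` of Borel probability measures `μ` on `Y` such that
`∫ d(y₀, y) μ(dy) < ∞` for some `y₀ : Y`. -/
@[ext]
structure WassersteinSpace (Y : Type*) [MetricSpace Y] [MeasurableSpace Y] where
  toMeasure : Measure Y
  isProbabilityMeasure : IsProbabilityMeasure toMeasure
  finite_moment : ∃ y₀ : Y, ∫⁻ y, edist y₀ y ∂toMeasure < ∞

/-- `Cpl(μ, ν)`: the measures on `Y × Y` with marginals `μ` and `ν` (they are automatically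
probability measures when `μ` and `ν` are). -/
def couplings {Y : Type*} [MeasurableSpace Y] (μ ν : Measure Y) : Set (Measure (Y × Y)) :=
  {π | π.map Prod.fst = μ ∧ π.map Prod.snd = ν}

/-- The infimum over all couplings of `μ` and `ν` of the transport cost `∫ d(y₁, y₂) dπ`,
as an extended nonnegative real. -/
def transportCost {Y : Type*} [MetricSpace Y] [MeasurableSpace Y] (μ ν : Measure Y) : ℝ≥0∞ :=
  ⨅ π ∈ couplings μ ν, ∫⁻ p : Y × Y, edist p.1 p.2 ∂π

section WassersteinMetric

variable {Y : Type*} [MetricSpace Y] [SeparableSpace Y] [MeasurableSpace Y] [BorelSpace Y]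

lemma transportCost_self (μ : Measure Y) : transportCost μ μ = 0 := by
  have hm : Measurable (fun y : Y => (y, y)) := by fun_prop
  refine le_antisymm ?_ bot_le
  refine (iInf₂_le (μ.map (fun y : Y => (y, y))) ⟨?_, ?_⟩).trans ?_
  · rw [lintegral_map (by fun_prop) hm]; simp
  · rw [Measure.map_map measurable_fst hm]; exact Measure.map_id
  · rw [Measure.map_map measurable_snd hm]; exact Measure.map_id

lemma transportCost_comm_le (μ ν : Measure Y) : transportCost μ ν ≤ transportCost ν μ := by
  refine le_iInf₂ fun π hπ => ?_
  refine (iInf₂_le (π.map Prod.swap) ⟨?_, ?_⟩).trans ?_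
  · rw [lintegral_map (by fun_prop) measurable_swap]
    exact (lintegral_congr fun p => edist_comm _ _).le
  · rw [Measure.map_map measurable_fst measurable_swap]; exact hπ.2
  · rw [Measure.map_map measurable_snd measurable_swap]; exact hπ.1

lemma transportCost_triangle [CompleteSpace Y] (μ ν κ : Measure Y) [IsProbabilityMeasure ν] :
    transportCost μ κ ≤ transportCost μ ν + transportCost ν κ := by
  have : PolishSpace Y := inferInstance
  have : Nonempty Y := nonempty_of_isProbabilityMeasure ν
  simp only [transportCost, ENNReal.iInf_add, ENNReal.add_iInf]
  refine le_iInf₂ fun ρ hρ => le_iInf₂ fun π hπ => ?_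
  have : IsProbabilityMeasure ρ := by
    constructor
    have h := congrArg (fun m => m Set.univ) hρ.1
    simpa [Measure.map_apply measurable_fst MeasurableSet.univ] using h
  have : IsProbabilityMeasure π := by
    constructor
    have h := congrArg (fun m => m Set.univ) hπ.2
    simpa [Measure.map_apply measurable_snd MeasurableSet.univ] using h
  let K : Kernel (Y × Y) Y := ρ.condKernel.comap Prod.snd measurable_snd
  let γ : Measure ((Y × Y) × Y) := π ⊗ₘ K
  have hγ1 : γ.map Prod.fst = π := Measure.fst_compProd π K
  have h23 : Measurable (fun p : (Y × Y) × Y => (p.1.2, p.2)) := by fun_prop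
  have h13 : Measurable (fun p : (Y × Y) × Y => (p.1.1, p.2)) := by fun_prop
  have hγ2 : γ.map (fun p => (p.1.2, p.2)) = ρ := by
    conv_rhs => rw [← ρ.disintegrate ρ.condKernel]
    ext s hs
    have hf : ρ.fst = π.map Prod.snd := by
      rw [hπ.2]; exact hρ.1
    rw [Measure.map_apply h23 hs, Measure.compProd_apply (h23 hs), Measure.compProd_apply hs, hf,
      lintegral_map (Kernel.measurable_kernel_prodMk_left hs) measurable_snd]
    rfl
  refine (iInf₂_le (γ.map (fun p => (p.1.1, p.2))) ⟨?_, ?_⟩).trans ?_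
  · calc ∫⁻ p, edist p.1 p.2 ∂(γ.map (fun p => (p.1.1, p.2)))
        = ∫⁻ p, edist p.1.1 p.2 ∂γ := lintegral_map (by fun_prop) h13
      _ ≤ ∫⁻ p, (edist p.1.1 p.1.2 + edist p.1.2 p.2) ∂γ :=
          lintegral_mono fun p => edist_triangle _ _ _
      _ = ∫⁻ p, edist p.1.1 p.1.2 ∂γ + ∫⁻ p, edist p.1.2 p.2 ∂γ :=
          lintegral_add_left (by fun_prop) _
      _ = ∫⁻ p, edist p.1 p.2 ∂π + ∫⁻ p, edist p.1 p.2 ∂ρ := by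
          conv_rhs => rw [← hγ1, ← hγ2, lintegral_map (by fun_prop) measurable_fst,
            lintegral_map (by fun_prop) h23]
  · rw [Measure.map_map measurable_fst h13, ← hπ.1]
    conv_rhs => rw [← hγ1, Measure.map_map measurable_fst measurable_fst]
    rfl
  · rw [Measure.map_map measurable_snd h13, ← hρ.2]
    conv_rhs => rw [← hγ2, Measure.map_map measurable_snd h23]
    rfl

lemma transportCost_ne_top (μ ν : WassersteinSpace Y) :
    transportCost μ.toMeasure ν.toMeasure ≠ ∞ := by
  have := μ.isProbabilityMeasure
  have := ν.isProbabilityMeasure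
  obtain ⟨a, ha⟩ := μ.finite_moment
  obtain ⟨b, hb⟩ := ν.finite_moment
  have hF : (μ.toMeasure.prod ν.toMeasure).map Prod.fst = μ.toMeasure := by simp
  have hS : (μ.toMeasure.prod ν.toMeasure).map Prod.snd = ν.toMeasure := by simp
  refine ne_top_of_le_ne_top ?_ (iInf₂_le (μ.toMeasure.prod ν.toMeasure) ⟨hF, hS⟩)
  have h1 : ∫⁻ p : Y × Y, edist a p.1 ∂(μ.toMeasure.prod ν.toMeasure)
      = ∫⁻ y, edist a y ∂μ.toMeasure := by
    conv_rhs => rw [← hF, lintegral_map (by fun_prop) measurable_fst]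
  have h2 : ∫⁻ p : Y × Y, edist b p.2 ∂(μ.toMeasure.prod ν.toMeasure)
      = ∫⁻ y, edist b y ∂ν.toMeasure := by
    conv_rhs => rw [← hS, lintegral_map (by fun_prop) measurable_snd]
  have hle : ∫⁻ p : Y × Y, edist p.1 p.2 ∂(μ.toMeasure.prod ν.toMeasure)
      ≤ ∫⁻ p : Y × Y, (edist a p.1 + (edist a b + edist b p.2))
          ∂(μ.toMeasure.prod ν.toMeasure) := by
    refine lintegral_mono fun p => (edist_triangle p.1 a p.2).trans ?_
    rw [edist_comm p.1 a]
    exact add_le_add le_rfl (edist_triangle _ _ _)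
  refine ne_top_of_le_ne_top ?_ hle
  rw [lintegral_add_left (by fun_prop), lintegral_add_left (by fun_prop), h1, h2, lintegral_const,
    measure_univ, mul_one]
  exact ENNReal.add_ne_top.2 ⟨ha.ne, ENNReal.add_ne_top.2 ⟨edist_ne_top _ _, hb.ne⟩⟩

lemma measure_le_of_transportCost_eq_zero (μ ν : Measure Y) (h : transportCost μ ν = 0)
    {ε : ℝ≥0∞} (hε : 0 < ε) (hε' : ε < ∞) (B : Set Y) (hB : MeasurableSet B) :
    μ B ≤ ν (Metric.thickening ε.toReal B) + ε := by
  have hlt : transportCost μ ν < ε * ε := by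
    rw [h]; exact ENNReal.mul_pos hε.ne' hε.ne'
  simp only [transportCost, iInf_lt_iff] at hlt
  obtain ⟨π, hπ, hc⟩ := hlt
  have hT : MeasurableSet (Metric.thickening ε.toReal B) := Metric.isOpen_thickening.measurableSet
  have hM : π {p : Y × Y | ε ≤ edist p.1 p.2} ≤ ε := by
    have h1 := mul_meas_ge_le_lintegral (μ := π)
      (f := fun p : Y × Y => edist p.1 p.2) (by fun_prop) ε
    exact (ENNReal.mul_le_mul_iff_right hε.ne' hε'.ne).1 (h1.trans hc.le)
  have hsub : Prod.fst ⁻¹' B ⊆ (Prod.snd ⁻¹' (Metric.thickening ε.toReal B))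
      ∪ {p : Y × Y | ε ≤ edist p.1 p.2} := by
    intro p hp
    by_cases hd : ε ≤ edist p.1 p.2
    · exact Or.inr hd
    · refine Or.inl (Metric.mem_thickening_iff.2 ⟨p.1, hp, ?_⟩)
      rw [dist_comm, dist_edist]
      exact (ENNReal.toReal_lt_toReal (edist_ne_top _ _) hε'.ne).2 (not_le.1 hd)
  have e1 : μ B = π (Prod.fst ⁻¹' B) := by
    rw [← Measure.map_apply measurable_fst hB, hπ.1]
  have e2 : ν (Metric.thickening ε.toReal B)
      = π (Prod.snd ⁻¹' (Metric.thickening ε.toReal B)) := by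
    rw [← Measure.map_apply measurable_snd hT, hπ.2]
  rw [e1, e2]
  exact (measure_mono hsub).trans ((measure_union_le _ _).trans (add_le_add le_rfl hM))

lemma eq_of_transportCost_eq_zero (μ ν : WassersteinSpace Y)
    (h : transportCost μ.toMeasure ν.toMeasure = 0) : μ = ν := by
  have := μ.isProbabilityMeasure
  have := ν.isProbabilityMeasure
  have h' : transportCost ν.toMeasure μ.toMeasure = 0 :=
    le_antisymm ((transportCost_comm_le _ _).trans h.le) bot_le
  have hLP : levyProkhorovEDist μ.toMeasure ν.toMeasure = 0 := by
    refine le_antisymm (levyProkhorovEDist_le_of_forall _ _ 0 fun ε B h0 h1 hB => ⟨?_, ?_⟩) bot_le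
    · exact measure_le_of_transportCost_eq_zero _ _ h h0 h1 B hB
    · exact measure_le_of_transportCost_eq_zero _ _ h' h0 h1 B hB
  apply WassersteinSpace.ext
  refine ext_of_generate_finite _ (borel_eq_generateFrom_isClosed (α := Y) ▸ BorelSpace.measurable_eq)
    isPiSystem_isClosed (fun s hs => ?_) (by simp)
  exact measure_eq_measure_of_levyProkhorovEDist_eq_zero_of_isClosed hLP hs
    ⟨1, one_pos, measure_ne_top _ _⟩ ⟨1, one_pos, measure_ne_top _ _⟩

/-- The Wasserstein-1 metric on `𝒫₁(Y)`,
`W₁(μ, ν) = inf_{π ∈ Cpl(μ, ν)} ∫ d(y₁, y₂) dπ(y₁, y₂)`. -/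
instance WassersteinSpace.instMetricSpace [CompleteSpace Y] : MetricSpace (WassersteinSpace Y) :=
  letI : EMetricSpace (WassersteinSpace Y) :=
    { edist := fun μ ν => transportCost μ.toMeasure ν.toMeasure
      edist_self := fun μ => transportCost_self μ.toMeasure
      edist_comm := fun μ ν => le_antisymm (transportCost_comm_le _ _) (transportCost_comm_le _ _)
      edist_triangle := fun μ ν κ =>
        have := ν.isProbabilityMeasure
        transportCost_triangle μ.toMeasure ν.toMeasure κ.toMeasure
      eq_of_edist_eq_zero := fun {μ ν} h => eq_of_transportCost_eq_zero μ ν h }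
  EMetricSpace.toMetricSpace transportCost_ne_top

lemma WassersteinSpace.edist_eq [CompleteSpace Y] (μ ν : WassersteinSpace Y) :
    edist μ ν = transportCost μ.toMeasure ν.toMeasure := rfl

end WassersteinMetric

/-! ### Feedforward networks and the measure-valued model class -/

/-- The functions `ℝᵈ → ℝᴰ` of the form `W_{J+1} ∘ (σ • W_J) ∘ ⋯ ∘ (σ • W_1)`, with affine maps
`W_j` between Euclidean spaces of arbitrary dimensions and `σ` applied componentwise
(`J` hidden layers). -/
def networksOfDepth (σ : ℝ → ℝ) (D : ℕ) :
    ℕ → (d : ℕ) → Set (EuclideanSpace ℝ (Fin d) → EuclideanSpace ℝ (Fin D))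
  | 0, d => {f | ∃ W : EuclideanSpace ℝ (Fin d) →ᵃ[ℝ] EuclideanSpace ℝ (Fin D), f = W}
  | J + 1, d => {f | ∃ (m : ℕ) (W : EuclideanSpace ℝ (Fin d) →ᵃ[ℝ] EuclideanSpace ℝ (Fin m)),
      ∃ g ∈ networksOfDepth σ D J m, f = fun x => g (WithLp.toLp 2 fun i => σ (W x i))}

/-- The class of feedforward networks from `ℝᵈ` to `ℝᴰ` with activation function `σ`, of arbitrary
width and arbitrary depth `J ≥ 1`. -/
def feedforwardNetworks (σ : ℝ → ℝ) (d D : ℕ) :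
    Set (EuclideanSpace ℝ (Fin d) → EuclideanSpace ℝ (Fin D)) :=
  {f | ∃ J : ℕ, 1 ≤ J ∧ f ∈ networksOfDepth σ D J d}

/-- `Softmax_N(x)_n = exp(x_n) / ∑ₖ exp(x_k)`. -/
def softmax {N : ℕ} (x : EuclideanSpace ℝ (Fin N)) (n : Fin N) : ℝ :=
  Real.exp (x n) / ∑ k, Real.exp (x k)

/-- The Kidger–Lyons condition: `σ` is continuous, non-affine, and differentiable at some point
with a non-zero derivative there. -/
structure KidgerLyons (σ : ℝ → ℝ) : Prop where
  continuous : Continuous σ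
  non_affine : ¬ ∃ a b : ℝ, ∀ x, σ x = a * x + b
  exists_deriv_ne_zero : ∃ x c : ℝ, c ≠ 0 ∧ HasDerivAt σ c x

/-- The model class: all `F ∈ C(X, 𝒫₁(Y))` of the form
`F(x) = ∑ₙ (Softmax_N (f̂ (φ x)))ₙ μₙ` with `N ≥ 1`, a feedforward network `f̂ : ℝᵈ → ℝᴺ` and
`μ₁, …, μ_N ∈ 𝒟`. -/
def modelClass {X Y : Type*} [MetricSpace X] [MetricSpace Y] [CompleteSpace Y] [SeparableSpace Y]
    [MeasurableSpace Y] [BorelSpace Y] {d : ℕ} (σ : ℝ → ℝ) (φ : C(X, EuclideanSpace ℝ (Fin d)))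
    (𝒟 : Set (WassersteinSpace Y)) : Set C(X, WassersteinSpace Y) :=
  {F | ∃ N : ℕ, 1 ≤ N ∧ ∃ f ∈ feedforwardNetworks σ d N, ∃ μ : Fin N → WassersteinSpace Y,
    (∀ n, μ n ∈ 𝒟) ∧
    ∀ x, (F x).toMeasure = ∑ n, ENNReal.ofReal (softmax (f (φ x)) n) • (μ n).toMeasure}

end

/-!
The argument has two independent parts, joined by a Gibbs-type choice of the logits.

*Networks.* A continuous non-affine `σ` generates `x ↦ x²`. Indeed a closed subspace of `C(ℝ, ℝ)`
that is invariant under `x ↦ a x + b` and contains `σ` contains its moving averages; a double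
moving average is `C²`, its second derivative is a second difference of `σ`, and this is nonzero
somewhere because `σ` is not affine. Rescaled symmetric second differences then converge to a
multiple of `x²` (`sq_mem_of_isClosed_of_affine_invariant`). Hence one extra layer can square, and
by polarization multiply, limits of networks, so that the limits of networks of arbitrary depth
form an algebra. By Stone–Weierstrass, networks composed with an injective `ψ` on a compact space
are dense (`exists_feedforwardNetworks_abs_sub_le`). Working with `ψ` from the start avoids
extending functions from the image of `ψ`.

*Mixtures.* Convexity of the transport cost gives
`W₁(ν, ∑ qₙ μₙ) ≤ ∑ qₙ W₁(ν, μₙ)` (`WassersteinSpace.dist_mixture_le`), and the same inequality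
yields continuity of mixtures in their weights (`WassersteinSpace.continuous_mixture`).

To approximate `F` on a compact `K`, choose `μ₁, …, μ_N ∈ 𝒟` forming a net of `F(K)` and let a
network approximate the logits `-b W₁(F x, μₙ)` up to `1`. For large `b` the softmax weights are
concentrated on those `n` with `μₙ` close to `F x`, so `∑ qₙ W₁(F x, μₙ)` is small
(`sum_softmax_mul_le`).
-/

/-! ### Closed affine-invariant spaces of continuous functions on the line -/

section AffineInvariant

open Filter Topology

lemma ContinuousMap.mem_closure_of_forall_isCompact {α β : Type*} [TopologicalSpace α]
    [PseudoMetricSpace β] {s : Set C(α, β)} {F : C(α, β)}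
    (h : ∀ K : Set α, IsCompact K → ∀ ε > 0, ∃ g ∈ s, ∀ x ∈ K, dist (F x) (g x) < ε) :
    F ∈ closure s := by
  have hb := nhds_basis_uniformity'
    (Metric.uniformity_basis_dist (α := β)).compactConvergenceUniformity (x := F)
  rw [mem_closure_iff_nhds_basis hb]
  rintro ⟨K, ε⟩ ⟨hK, hε⟩
  obtain ⟨g, hg, hgK⟩ := h K hK ε hε
  exact ⟨g, hg, hgK⟩

/-- The moving average `x ↦ ∫ t in x..x+1, f t`. -/
noncomputable def movingAverage (f : C(ℝ, ℝ)) : C(ℝ, ℝ) where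
  toFun x := ∫ t in (0 : ℝ)..1, f (x + t)
  continuous_toFun :=
    intervalIntegral.continuous_parametric_intervalIntegral_of_continuous' (by fun_prop) 0 1

lemma hasDerivAt_movingAverage (f : C(ℝ, ℝ)) (x : ℝ) :
    HasDerivAt (movingAverage f) (f (x + 1) - f x) x := by
  have hi : ∀ a b, IntervalIntegrable f volume a b := fun a b => f.continuous.intervalIntegrable a b
  have hd : ∀ x, HasDerivAt (fun u => ∫ t in (0 : ℝ)..u, f t) (f x) x := fun x =>
    intervalIntegral.integral_hasDerivAt_right (hi _ _)
      (f.continuous.stronglyMeasurableAtFilter _ _) f.continuous.continuousAt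
  have h := ((hd (x + 1)).comp_add_const x 1).sub (hd x)
  refine h.congr_of_eventuallyEq (Eventually.of_forall fun y => ?_)
  simp only [movingAverage, ContinuousMap.coe_mk, Pi.sub_apply]
  rw [intervalIntegral.integral_interval_sub_left (hi _ _) (hi _ _),
    intervalIntegral.integral_comp_add_left (fun t => f t) y, add_zero]

variable {V : Submodule ℝ C(ℝ, ℝ)}

/-- On a compact set the moving average is a Bochner integral of translates. -/
lemma movingAverage_mem (hV : IsClosed (V : Set C(ℝ, ℝ)))
    (haff : ∀ f ∈ V, ∀ a b : ℝ, f.comp ⟨fun x => a * x + b, by fun_prop⟩ ∈ V)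
    {f : C(ℝ, ℝ)} (hf : f ∈ V) : movingAverage f ∈ V := by
  rw [← SetLike.mem_coe, ← hV.closure_eq]
  refine ContinuousMap.mem_closure_of_forall_isCompact fun K hK ε hε => ?_
  have : CompactSpace K := isCompact_iff_compactSpace.1 hK
  let T : ℝ → C(K, ℝ) := fun t => (f.comp ⟨fun x => x + t, by fun_prop⟩).restrict K
  have hT : Continuous T := by
    have : Continuous fun p : ℝ × K => f (p.2 + p.1) := by fun_prop
    exact (ContinuousMap.curry ⟨_, this⟩).continuous
  let r : C(ℝ, ℝ) →ₗ[ℝ] C(K, ℝ) := (ContinuousMap.compRightAlgHom ℝ ℝ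
    (⟨Subtype.val, continuous_subtype_val⟩ : C(K, ℝ))).toLinearMap
  let S : Submodule ℝ C(K, ℝ) := (V.map r).topologicalClosure
  have hTS : ∀ t, T t ∈ S := fun t =>
    (V.map r).le_topologicalClosure ⟨_, haff f hf 1 t, by
      ext x; simp [r, T]⟩
  have : IsProbabilityMeasure (volume.restrict (Set.Ioc (0 : ℝ) 1)) := ⟨by simp⟩
  have hint : IntervalIntegrable T volume 0 1 := hT.intervalIntegrable 0 1
  have hI : ∫ t in (0 : ℝ)..1, T t ∈ S := by
    rw [intervalIntegral.integral_of_le zero_le_one]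
    exact S.convex.integral_mem (V.map r).isClosed_topologicalClosure
      (Eventually.of_forall hTS) ((intervalIntegrable_iff_integrableOn_Ioc_of_le zero_le_one).1 hint)
  obtain ⟨_, ⟨g, hg, rfl⟩, hd⟩ := Metric.mem_closure_iff.1 hI ε hε
  refine ⟨g, hg, fun x hx => ?_⟩
  have h1 : (∫ t in (0 : ℝ)..1, T t) ⟨x, hx⟩ = movingAverage f x := by
    have := (ContinuousMap.evalCLM ℝ (⟨x, hx⟩ : K)).intervalIntegral_comp_comm hint
    exact this.symm
  have h2 := (ContinuousMap.dist_apply_le_dist (⟨x, hx⟩ : K)).trans_lt hd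
  rwa [h1] at h2

/-- The symmetric second difference quotient of a `C²` function converges to its second
derivative. -/
lemma tendsto_symmetric_second_difference {F G H : ℝ → ℝ} (hF : ∀ x, HasDerivAt F (G x) x)
    (hG : ∀ x, HasDerivAt G (H x) x) :
    Tendsto (fun u => (F u + F (-u) - 2 * F 0) / u ^ 2) (𝓝[≠] 0) (𝓝 (H 0)) := by
  have hneg : ∀ {A B : ℝ → ℝ}, (∀ x, HasDerivAt A (B x) x) →
      ∀ x, HasDerivAt (fun u => A (-u)) (-B (-x)) x := fun h x => by
    simpa [Function.comp_def] using (h (-x)).comp x (hasDerivAt_neg x)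
  have hslope : Tendsto (fun u => (G u - G (-u)) / (2 * u)) (𝓝[≠] 0) (𝓝 (H 0)) := by
    have h := (((hG 0).sub (hneg hG 0)).tendsto_slope.div_const 2)
    simp only [neg_zero] at h
    convert h using 1
    · ext u; simp [slope_def_field]; ring
    · congr 1; ring
  refine HasDerivAt.lhopital_zero_nhdsNE (f' := fun u => G u - G (-u)) (g' := fun u => 2 * u)
    (Eventually.of_forall fun x => ?_) (Eventually.of_forall fun x => ?_) ?_ ?_ ?_ hslope
  · simpa [sub_eq_add_neg] using ((hF x).add (hneg hF x)).sub_const (2 * F 0)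
  · simpa using hasDerivAt_pow 2 x
  · filter_upwards [self_mem_nhdsWithin] with x hx
    simpa using hx
  · have hc : Continuous F := continuous_iff_continuousAt.2 fun x => (hF x).continuousAt
    have : Continuous fun u => F u + F (-u) - 2 * F 0 := by fun_prop
    have h := this.tendsto 0
    simp only [neg_zero] at h
    rw [show F 0 + F 0 - 2 * F 0 = 0 by ring] at h
    exact h.mono_left nhdsWithin_le_nhds
  · have : Continuous fun u : ℝ => u ^ 2 := by fun_prop
    have h := this.tendsto 0
    simp only [ne_eq, OfNat.ofNat_ne_zero, not_false_eq_true, zero_pow] at h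
    exact h.mono_left nhdsWithin_le_nhds

/-- A continuous function whose second differences all vanish is affine: after subtracting its
value at `0` it is additive. -/
lemma exists_affine_of_second_difference_eq_zero {f : ℝ → ℝ} (hf : Continuous f)
    (h : ∀ x t, f (2 * t + x) - 2 * f (t + x) + f x = 0) : ∃ a b : ℝ, ∀ x, f x = a * x + b := by
  let g : ℝ →+ ℝ :=
    { toFun := fun x => f x - f 0
      map_zero' := by simp
      map_add' := fun x y => by
        have h1 := h x ((y - x) / 2)
        have h2 := h 0 ((x + y) / 2)
        rw [show 2 * ((y - x) / 2) + x = y by ring, show (y - x) / 2 + x = (x + y) / 2 by ring] at h1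
        rw [show 2 * ((x + y) / 2) + 0 = x + y by ring, add_zero] at h2
        linarith }
  have hg : Continuous g := by
    change Continuous fun x => f x - f 0
    fun_prop
  refine ⟨g 1, f 0, fun x => ?_⟩
  have h1 : g x = x * g 1 := by simpa using map_real_smul g hg x 1
  have h2 : g x = f x - f 0 := rfl
  linarith

/-- The double moving average `F` of a suitable member of `V` is `C²` with `F''(0) ≠ 0`. The
functions `x ↦ (F (t x) + F (- t x) - 2 F 0) / t²` lie in `V` and tend to `F''(0) x²` as
`t → 0`. -/
lemma sq_mem_of_isClosed_of_affine_invariant (hV : IsClosed (V : Set C(ℝ, ℝ)))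
    (haff : ∀ f ∈ V, ∀ a b : ℝ, f.comp ⟨fun x => a * x + b, by fun_prop⟩ ∈ V)
    {σ : C(ℝ, ℝ)} (hσ : σ ∈ V) (hna : ¬ ∃ a b : ℝ, ∀ x, σ x = a * x + b) :
    (⟨fun x => x ^ 2, by fun_prop⟩ : C(ℝ, ℝ)) ∈ V := by
  obtain ⟨x₀, h₀, hne⟩ : ∃ x t, σ (2 * t + x) - 2 * σ (t + x) + σ x ≠ 0 := by
    by_contra! hcon
    exact hna (exists_affine_of_second_difference_eq_zero σ.continuous hcon)
  -- An affine substitution moves the nonzero second difference to the points `0, 1, 2`.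
  let f : C(ℝ, ℝ) := σ.comp ⟨fun x => h₀ * x + x₀, by fun_prop⟩
  let F : C(ℝ, ℝ) := movingAverage (movingAverage f)
  have hFV : F ∈ V := movingAverage_mem hV haff (movingAverage_mem hV haff (haff σ hσ h₀ x₀))
  let H : ℝ → ℝ := fun x => (f (x + 1 + 1) - f (x + 1)) - (f (x + 1) - f x)
  have hH0 : H 0 ≠ 0 := by
    convert hne using 1
    simp only [H, f, ContinuousMap.comp_apply, ContinuousMap.coe_mk]
    ring_nf
  have hlim := tendsto_symmetric_second_difference (F := F)
    (G := fun x => movingAverage f (x + 1) - movingAverage f x) (H := H)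
    (hasDerivAt_movingAverage _)
    fun x => ((hasDerivAt_movingAverage f (x + 1)).comp_add_const x 1).sub
      (hasDerivAt_movingAverage f x)
  -- The second difference quotient `Q`, extended continuously to `0`.
  let Q : ℝ → ℝ := Function.update (fun u => (F u + F (-u) - 2 * F 0) / u ^ 2) 0 (H 0)
  have hQ : Continuous Q := by
    refine continuous_iff_continuousAt.2 fun u => ?_
    rcases eq_or_ne u 0 with rfl | hu
    · exact continuousAt_update_same.2 hlim
    · refine (continuousAt_update_of_ne hu).2 ?_
      exact ContinuousAt.div (by fun_prop) (by fun_prop) (pow_ne_zero 2 hu)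
  -- Joint continuity of `(t, x) ↦ x² Q (t x)` is continuity of `t ↦ x² Q (t x)` into `C(ℝ, ℝ)`.
  let P : C(ℝ, C(ℝ, ℝ)) := ContinuousMap.curry ⟨fun p => p.2 ^ 2 * Q (p.1 * p.2), by fun_prop⟩
  have hconst : ContinuousMap.const ℝ (F 0) ∈ V := by
    convert haff F hFV 0 0 using 1
    ext x; simp
  have hPV : ∀ t : ℝ, t ≠ 0 → P t ∈ V := fun t ht => by
    have hmem : (t ^ 2)⁻¹ • (F.comp ⟨fun x => t * x + 0, by fun_prop⟩
        + F.comp ⟨fun x => (-t) * x + 0, by fun_prop⟩ - (2 : ℝ) • ContinuousMap.const ℝ (F 0)) ∈ V :=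
      V.smul_mem _ (V.sub_mem (V.add_mem (haff F hFV _ _) (haff F hFV _ _))
        (V.smul_mem _ hconst))
    convert hmem using 1
    ext x
    rcases eq_or_ne x 0 with rfl | hx
    · simp [P]; right; ring
    · have : t * x ≠ 0 := mul_ne_zero ht hx
      simp [P, Q, Function.update_of_ne this]
      field_simp
  have hP0 : P 0 ∈ V := by
    refine hV.mem_of_tendsto (b := 𝓝[≠] (0 : ℝ))
      ((P.continuous.tendsto 0).mono_left nhdsWithin_le_nhds) ?_
    filter_upwards [self_mem_nhdsWithin] with t ht using hPV t ht
  convert V.smul_mem (H 0)⁻¹ hP0 using 1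
  ext x
  simp [P, Q]
  field_simp

end AffineInvariant

/-! ### Universal approximation by feedforward networks -/

section Networks

open Filter Topology

/-- The real-valued networks with `J` hidden layers, built from the input side: affine functions
for `J = 0`, and the linear combinations of `σ ∘ g` with `g` of depth `J` for `J + 1`. Biases of
the later layers need no separate generator, since constants are themselves combinations of
`σ ∘ c` with `c` constant as soon as `σ ≠ 0`. -/
noncomputable def scalarNetworks (σ : C(ℝ, ℝ)) (d : ℕ) :
    ℕ → Submodule ℝ C(EuclideanSpace ℝ (Fin d), ℝ)
  | 0 =>
    { carrier := {f | ∃ W : EuclideanSpace ℝ (Fin d) →ᵃ[ℝ] ℝ, ⇑f = W}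
      zero_mem' := ⟨0, rfl⟩
      add_mem' := by
        rintro f g ⟨W, hW⟩ ⟨W', hW'⟩
        exact ⟨W + W', by simp [hW, hW']⟩
      smul_mem' := by
        rintro c f ⟨W, hW⟩
        exact ⟨c • W, by simp [hW]⟩ }
  | J + 1 => Submodule.span ℝ (σ.comp '' (scalarNetworks σ d J : Set _))

/-- `networksOfDepth` adds layers on the input side; layers can be added on the output side as
well. -/
lemma comp_activation_mem_networksOfDepth (σ : ℝ → ℝ) {m D : ℕ}
    (W : EuclideanSpace ℝ (Fin m) →ᵃ[ℝ] EuclideanSpace ℝ (Fin D)) (J : ℕ) :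
    ∀ {d : ℕ} {g : EuclideanSpace ℝ (Fin d) → EuclideanSpace ℝ (Fin m)},
      g ∈ networksOfDepth σ m J d →
      (fun x => W (WithLp.toLp 2 fun i => σ (g x i))) ∈ networksOfDepth σ D (J + 1) d := by
  induction J with
  | zero =>
    rintro d _ ⟨W₀, rfl⟩
    exact ⟨m, W₀, W, ⟨W, rfl⟩, rfl⟩
  | succ J ih =>
    rintro d _ ⟨m', W', g', hg', rfl⟩
    exact ⟨m', W', _, ih hg', rfl⟩

/-- Networks of equal depth can be run in parallel. -/
lemma toLp_mem_networksOfDepth (σ : C(ℝ, ℝ)) {d : ℕ} (J : ℕ) :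
    ∀ {N : ℕ} {f : Fin N → C(EuclideanSpace ℝ (Fin d), ℝ)},
      (∀ n, f n ∈ scalarNetworks σ d J) →
      (fun x => WithLp.toLp 2 fun n => f n x) ∈ networksOfDepth σ N J d := by
  induction J with
  | zero =>
    intro N f hf
    choose W hW using hf
    refine ⟨(WithLp.linearEquiv 2 ℝ (Fin N → ℝ)).symm.toLinearMap.toAffineMap.comp
      (AffineMap.pi W), ?_⟩
    funext x
    ext n
    simp [hW]
  | succ J ih =>
    intro N f hf
    have hf' := fun n => Submodule.mem_span_set'.1 (hf n)
    choose k c g hg using hf'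
    choose u hu hgu using fun n i => (g n i).2
    let e : (Σ n, Fin (k n)) ≃ Fin (Fintype.card (Σ n, Fin (k n))) := Fintype.equivFin _
    let L : EuclideanSpace ℝ (Fin (Fintype.card (Σ n, Fin (k n)))) →ₗ[ℝ]
        EuclideanSpace ℝ (Fin N) :=
      { toFun := fun y => WithLp.toLp 2 fun n => ∑ i, c n i * y (e ⟨n, i⟩)
        map_add' := fun x y => by ext n; simp [mul_add, Finset.sum_add_distrib]
        map_smul' := fun a x => by
          ext n; simp [Finset.mul_sum, mul_left_comm] }
    have h := comp_activation_mem_networksOfDepth σ L.toAffineMap J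
      (ih (f := fun j => u (e.symm j).1 (e.symm j).2) fun j => hu _ _)
    convert h using 1
    funext x
    ext n
    simp only [← hg, ← hgu, L, LinearMap.coe_toAffineMap, LinearMap.coe_mk, AddHom.coe_mk,
      ContinuousMap.sum_apply, ContinuousMap.smul_apply, ContinuousMap.comp_apply, smul_eq_mul]
    refine Finset.sum_congr rfl fun i _ => ?_
    rw [e.symm_apply_apply]

section Approximation

variable {K : Type*} [TopologicalSpace K] [CompactSpace K] {d : ℕ}

/-- The uniform limits on `K` of the functions `f ∘ ψ`, where `f` is a real-valued network with `J`
hidden layers. -/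
noncomputable def networkLimits (σ : C(ℝ, ℝ)) (ψ : C(K, EuclideanSpace ℝ (Fin d))) (J : ℕ) :
    Submodule ℝ C(K, ℝ) :=
  ((scalarNetworks σ d J).map
    (ContinuousMap.compRightAlgHom ℝ ℝ ψ).toLinearMap).topologicalClosure

variable {σ : C(ℝ, ℝ)} {ψ : C(K, EuclideanSpace ℝ (Fin d))}

lemma comp_mem_networkLimits {J : ℕ} {f : C(EuclideanSpace ℝ (Fin d), ℝ)}
    (hf : f ∈ scalarNetworks σ d J) : f.comp ψ ∈ networkLimits σ ψ J :=
  Submodule.le_topologicalClosure _ ⟨f, hf, rfl⟩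

lemma activation_comp_mem_networkLimits {J : ℕ} {f : C(K, ℝ)} (hf : f ∈ networkLimits σ ψ J) :
    σ.comp f ∈ networkLimits σ ψ (J + 1) := by
  refine map_mem_closure (ContinuousMap.continuous_postcomp σ) hf ?_
  rintro _ ⟨g, hg, rfl⟩
  exact ⟨σ.comp g, Submodule.subset_span ⟨g, hg, rfl⟩, rfl⟩

lemma exists_ne_zero_of_not_affine {f : ℝ → ℝ} (hna : ¬ ∃ a b : ℝ, ∀ x, f x = a * x + b) :
    ∃ t, f t ≠ 0 := by
  by_contra! h
  exact hna ⟨0, 0, fun x => by simp [h]⟩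

lemma const_mem_networkLimits (hσ : ∃ t, σ t ≠ 0) (J : ℕ) (c : ℝ) :
    ContinuousMap.const K c ∈ networkLimits σ ψ J := by
  induction J generalizing c with
  | zero =>
    exact comp_mem_networkLimits (f := ContinuousMap.const _ c) ⟨AffineMap.const ℝ _ c, rfl⟩
  | succ J ih =>
    obtain ⟨t, ht⟩ := hσ
    convert Submodule.smul_mem _ (c / σ t) (activation_comp_mem_networkLimits (ih t)) using 1
    ext x
    simp [ht]

/-- The functions `q` which may serve as an additional activation in the closure form a closed
affine-invariant space containing `σ`, hence contain `x ↦ x²`. -/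
lemma sq_mem_networkLimits (hna : ¬ ∃ a b : ℝ, ∀ x, σ x = a * x + b) {J : ℕ} {f : C(K, ℝ)}
    (hf : f ∈ networkLimits σ ψ J) : f ^ 2 ∈ networkLimits σ ψ (J + 1) := by
  have hσ := exists_ne_zero_of_not_affine hna
  let V : Submodule ℝ C(ℝ, ℝ) :=
    { carrier := {q | ∀ f ∈ networkLimits σ ψ J, q.comp f ∈ networkLimits σ ψ (J + 1)}
      zero_mem' := fun f _ => by
        rw [ContinuousMap.zero_comp]; exact Submodule.zero_mem _
      add_mem' := fun hp hq f hf => by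
        rw [ContinuousMap.add_comp]; exact Submodule.add_mem _ (hp f hf) (hq f hf)
      smul_mem' := fun c q hq f hf => by
        rw [ContinuousMap.smul_comp]; exact Submodule.smul_mem _ c (hq f hf) }
  have hV : IsClosed (V : Set C(ℝ, ℝ)) := by
    have : (V : Set C(ℝ, ℝ)) = ⋂ f ∈ networkLimits σ ψ J,
        (fun q : C(ℝ, ℝ) => q.comp f) ⁻¹' (networkLimits σ ψ (J + 1) : Set C(K, ℝ)) := by
      ext q; simp [V]
    rw [this]
    exact isClosed_biInter fun f _ => (Submodule.isClosed_topologicalClosure _).preimage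
      (ContinuousMap.continuous_precomp f)
  refine sq_mem_of_isClosed_of_affine_invariant hV (fun q hq a b g hg => ?_)
    (fun g hg => activation_comp_mem_networkLimits hg) hna f hf
  have := hq (a • g + ContinuousMap.const K b)
    (Submodule.add_mem _ (Submodule.smul_mem _ a hg) (const_mem_networkLimits hσ J b))
  exact this

/-- `4 f = (f + 1)² - (f - 1)²`. -/
lemma networkLimits_mono (hna : ¬ ∃ a b : ℝ, ∀ x, σ x = a * x + b) :
    Monotone (networkLimits σ ψ) := by
  have hσ := exists_ne_zero_of_not_affine hna
  refine monotone_nat_of_le_succ fun J f hf => ?_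
  have h1 : (1 : C(K, ℝ)) ∈ networkLimits σ ψ J := const_mem_networkLimits hσ J 1
  convert Submodule.smul_mem _ (1 / 4 : ℝ) (Submodule.sub_mem _
    (sq_mem_networkLimits hna (Submodule.add_mem _ hf h1))
    (sq_mem_networkLimits hna (Submodule.sub_mem _ hf h1))) using 1
  ext x
  simp
  ring

/-- The networks of all depths have an algebra as closure, by `4 f g = (f + g)² - (f - g)²`, and
Stone–Weierstrass applies to it: affine functions already separate points. -/
lemma exists_mem_networkLimits_dist_lt (hna : ¬ ∃ a b : ℝ, ∀ x, σ x = a * x + b)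
    (hψ : Function.Injective ψ) (h : C(K, ℝ)) {ε : ℝ} (hε : 0 < ε) :
    ∃ J, ∃ f ∈ networkLimits σ ψ J, dist f h < ε := by
  have hmono := networkLimits_mono (ψ := ψ) hna
  have hσ := exists_ne_zero_of_not_affine hna
  let A : Subalgebra ℝ C(K, ℝ) :=
    { carrier := {f | ∃ J, f ∈ networkLimits σ ψ J}
      algebraMap_mem' := fun c => ⟨0, const_mem_networkLimits hσ 0 c⟩
      add_mem' := by
        rintro f g ⟨I, hf⟩ ⟨J, hg⟩
        exact ⟨max I J, Submodule.add_mem _ (hmono (le_max_left _ _) hf)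
          (hmono (le_max_right _ _) hg)⟩
      mul_mem' := by
        rintro f g ⟨I, hf⟩ ⟨J, hg⟩
        have hf' := hmono (le_max_left I J) hf
        have hg' := hmono (le_max_right I J) hg
        refine ⟨max I J + 1, ?_⟩
        convert Submodule.smul_mem _ (1 / 4 : ℝ) (Submodule.sub_mem _
          (sq_mem_networkLimits hna (Submodule.add_mem _ hf' hg'))
          (sq_mem_networkLimits hna (Submodule.sub_mem _ hf' hg'))) using 1
        ext x
        simp
        ring }
  have hA : A.SeparatesPoints := by
    intro x y hxy
    obtain ⟨i, hi⟩ : ∃ i, ψ x i ≠ ψ y i := by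
      by_contra! hcon
      exact hxy (hψ (PiLp.ext hcon))
    let p : C(EuclideanSpace ℝ (Fin d), ℝ) := ⟨fun z => z i, by fun_prop⟩
    refine ⟨p.comp ψ, ⟨p.comp ψ, ⟨0, comp_mem_networkLimits ?_⟩, rfl⟩, hi⟩
    exact ⟨(EuclideanSpace.proj i : EuclideanSpace ℝ (Fin d) →L[ℝ] ℝ).toLinearMap.toAffineMap, rfl⟩
  obtain ⟨⟨f, J, hf⟩, hfh⟩ :=
    ContinuousMap.exists_mem_subalgebra_near_continuousMap_of_separatesPoints A hA h ε hε
  exact ⟨J, f, hf, by rwa [dist_eq_norm]⟩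

/-- **Universal approximation**: networks precomposed with an injective continuous map `ψ` are
uniformly dense in the continuous vector-valued functions on a compact space. -/
lemma exists_feedforwardNetworks_abs_sub_le (hna : ¬ ∃ a b : ℝ, ∀ x, σ x = a * x + b)
    (hψ : Function.Injective ψ) {N : ℕ} (h : Fin N → C(K, ℝ)) {ε : ℝ} (hε : 0 < ε) :
    ∃ f ∈ feedforwardNetworks σ d N, Continuous f ∧ ∀ x n, |f (ψ x) n - h n x| ≤ ε := by
  choose J u hu hd using fun n => exists_mem_networkLimits_dist_lt hna hψ (h n) (half_pos hε)
  -- A common positive depth.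
  let M := Finset.univ.sup J + 1
  have hM : ∀ n, u n ∈ networkLimits σ ψ M := fun n =>
    networkLimits_mono hna ((Finset.le_sup (Finset.mem_univ n)).trans (Nat.le_succ _)) (hu n)
  have hv : ∀ n, ∃ v ∈ scalarNetworks σ d M, dist (u n) (v.comp ψ) < ε / 2 := fun n => by
    obtain ⟨_, ⟨v, hv, rfl⟩, hd⟩ := Metric.mem_closure_iff.1 (hM n) _ (half_pos hε)
    exact ⟨v, hv, hd⟩
  choose v hv hdv using hv
  refine ⟨_, ⟨M, Nat.le_add_left 1 _, toLp_mem_networksOfDepth σ M hv⟩, by fun_prop,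
    fun x n => ?_⟩
  have h1 := (ContinuousMap.dist_apply_le_dist (f := u n) (g := h n) x).trans (hd n).le
  have h2 := (ContinuousMap.dist_apply_le_dist (f := u n) (g := (v n).comp ψ) x).trans (hdv n).le
  rw [Real.dist_eq, abs_le] at h1 h2
  simp only [ContinuousMap.comp_apply] at h2
  simp only [abs_le]
  constructor <;> linarith [h1.1, h1.2, h2.1, h2.2]

end Approximation

end Networks

/-! ### Mixtures in the Wasserstein space -/

section Mixtures

open Filter Topology

/-- Convexity of the transport cost: a mixture of couplings couples the mixtures. -/
lemma transportCost_sum_smul_le {Y ι : Type*} [MetricSpace Y] [MeasurableSpace Y] [Fintype ι]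
    (w : ι → ℝ≥0∞) (hw : ∑ i, w i = 1) (ν μ : ι → Measure Y)
    (hT : ∀ i, transportCost (ν i) (μ i) ≠ ∞) :
    transportCost (∑ i, w i • ν i) (∑ i, w i • μ i)
      ≤ ∑ i, w i * transportCost (ν i) (μ i) := by
  refine ENNReal.le_of_forall_pos_le_add fun δ hδ _ => ?_
  have hex : ∀ i, ∃ π ∈ couplings (ν i) (μ i),
      ∫⁻ p : Y × Y, edist p.1 p.2 ∂π ≤ transportCost (ν i) (μ i) + δ := fun i => by
    have h := ENNReal.lt_add_right (hT i) (ENNReal.coe_pos.2 hδ).ne'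
    conv_lhs at h => rw [transportCost]
    simp only [iInf_lt_iff] at h
    obtain ⟨π, hπ, h⟩ := h
    exact ⟨π, hπ, h.le⟩
  choose π hπ hc using hex
  have hmap : ∀ {g : Y × Y → Y}, Measurable g →
      (∑ i, w i • π i).map g = ∑ i, w i • (π i).map g := fun hg => by
    simp only [← Measure.mapₗ_apply_of_measurable hg]
    simp
  refine (iInf₂_le (∑ i, w i • π i) ⟨?_, ?_⟩).trans ?_
  · calc ∫⁻ p, edist p.1 p.2 ∂(∑ i, w i • π i)
        = ∑ i, w i * ∫⁻ p, edist p.1 p.2 ∂(π i) := by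
          rw [lintegral_finsetSum_measure]; simp
      _ ≤ ∑ i, w i * (transportCost (ν i) (μ i) + δ) := by gcongr with i; exact hc i
      _ = ∑ i, w i * transportCost (ν i) (μ i) + δ := by
          simp only [mul_add, Finset.sum_add_distrib, ← Finset.sum_mul, hw, one_mul]
  · rw [hmap measurable_fst]
    exact Finset.sum_congr rfl fun i _ => by rw [(hπ i).1]
  · rw [hmap measurable_snd]
    exact Finset.sum_congr rfl fun i _ => by rw [(hπ i).2]

lemma WassersteinSpace.lintegral_edist_lt_top {Y : Type*} [MetricSpace Y] [MeasurableSpace Y]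
    (μ : WassersteinSpace Y) (y : Y) :
    ∫⁻ z, edist y z ∂μ.toMeasure < ∞ := by
  have := μ.isProbabilityMeasure
  obtain ⟨y₀, h⟩ := μ.finite_moment
  calc ∫⁻ z, edist y z ∂μ.toMeasure ≤ ∫⁻ z, (edist y y₀ + edist y₀ z) ∂μ.toMeasure :=
        lintegral_mono fun z => edist_triangle _ _ _
    _ = edist y y₀ + ∫⁻ z, edist y₀ z ∂μ.toMeasure := by
        rw [lintegral_add_left measurable_const]; simp
    _ < ∞ := ENNReal.add_lt_top.2 ⟨edist_lt_top _ _, h⟩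

variable {Y : Type*} [MetricSpace Y] [SeparableSpace Y] [MeasurableSpace Y] [BorelSpace Y]

/-- The mixture `∑ i, w i • μ i` of measures with finite first moment. -/
noncomputable def WassersteinSpace.mixture {ι : Type*} [Fintype ι] (w : ι → ℝ) (hw : ∀ i, 0 ≤ w i)
    (hsum : ∑ i, w i = 1) (μ : ι → WassersteinSpace Y) : WassersteinSpace Y where
  toMeasure := ∑ i, ENNReal.ofReal (w i) • (μ i).toMeasure
  isProbabilityMeasure := by
    have := fun i => (μ i).isProbabilityMeasure
    constructor
    simp [← ENNReal.ofReal_sum_of_nonneg fun i _ => hw i, hsum]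
  finite_moment := by
    obtain ⟨i, -⟩ : ∃ i, w i ≠ 0 := by
      by_contra! h
      simp [h] at hsum
    obtain ⟨y, -⟩ := (μ i).finite_moment
    refine ⟨y, ?_⟩
    rw [lintegral_finsetSum_measure]
    simp only [lintegral_smul_measure, smul_eq_mul]
    exact ENNReal.sum_lt_top.2 fun i _ =>
      ENNReal.mul_lt_top ENNReal.ofReal_lt_top ((μ i).lintegral_edist_lt_top y)

variable [CompleteSpace Y]

/-- Convexity of `W₁` in its second argument: write `ν` as the mixture of copies of itself. -/
lemma WassersteinSpace.dist_mixture_le {ι : Type*} [Fintype ι] (ν : WassersteinSpace Y)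
    (w : ι → ℝ) (hw : ∀ i, 0 ≤ w i) (hsum : ∑ i, w i = 1) (μ : ι → WassersteinSpace Y) :
    dist ν (mixture w hw hsum μ) ≤ ∑ i, w i * dist ν (μ i) := by
  have hsum' : ∑ i, ENNReal.ofReal (w i) = 1 := by
    rw [← ENNReal.ofReal_sum_of_nonneg fun i _ => hw i, hsum, ENNReal.ofReal_one]
  have h := transportCost_sum_smul_le (fun i => ENNReal.ofReal (w i)) hsum'
    (fun _ => ν.toMeasure) (fun i => (μ i).toMeasure) fun i => transportCost_ne_top ν (μ i)
  rw [← Finset.sum_smul, hsum', one_smul] at h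
  have hr : ∑ i, ENNReal.ofReal (w i) * transportCost ν.toMeasure (μ i).toMeasure
      = ENNReal.ofReal (∑ i, w i * dist ν (μ i)) := by
    rw [ENNReal.ofReal_sum_of_nonneg fun i _ => mul_nonneg (hw i) dist_nonneg]
    refine Finset.sum_congr rfl fun i _ => ?_
    rw [ENNReal.ofReal_mul (hw i), ← edist_dist, edist_eq]
  rw [hr] at h
  refine (ENNReal.ofReal_le_ofReal_iff
    (Finset.sum_nonneg fun i _ => mul_nonneg (hw i) dist_nonneg)).1 ?_
  rw [← edist_dist]
  exact h

/-- If `q i ≥ s * p i`, the mixture with weights `q` is a mixture of the one with weights `p`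
(with weight `s`) and the `μ i` (with weights `q i - s * p i`). -/
lemma WassersteinSpace.dist_mixture_mixture_le {ι : Type*} [Fintype ι] {p q : ι → ℝ}
    (hp : ∀ i, 0 ≤ p i) (hp1 : ∑ i, p i = 1) (hq : ∀ i, 0 ≤ q i) (hq1 : ∑ i, q i = 1)
    (μ : ι → WassersteinSpace Y) {s : ℝ} (hs : 0 ≤ s) (h : ∀ i, s * p i ≤ q i) :
    dist (mixture p hp hp1 μ) (mixture q hq hq1 μ)
      ≤ (1 - s) * ∑ i, dist (mixture p hp hp1 μ) (μ i) := by
  set ν := mixture p hp hp1 μ with hν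
  let w : Option ι → ℝ := fun o => o.elim s fun i => q i - s * p i
  have hw : ∀ o, 0 ≤ w o := by
    rintro (_ | i)
    · exact hs
    · exact sub_nonneg.2 (h i)
  have hw1 : ∑ o, w o = 1 := by
    simp [w, Fintype.sum_option, ← Finset.mul_sum, hp1, hq1]
  let κ : Option ι → WassersteinSpace Y := fun o => o.elim ν μ
  have heq : mixture q hq hq1 μ = mixture w hw hw1 κ := by
    apply WassersteinSpace.ext
    simp only [mixture, Fintype.sum_option, w, κ, Option.elim, hν, Finset.smul_sum, smul_smul,
      ← Finset.sum_add_distrib, ← add_smul]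
    refine Finset.sum_congr rfl fun i _ => ?_
    rw [← ENNReal.ofReal_mul hs,
      ← ENNReal.ofReal_add (mul_nonneg hs (hp i)) (sub_nonneg.2 (h i)), add_sub_cancel]
  rw [heq]
  refine (dist_mixture_le ν w hw hw1 κ).trans ?_
  rw [Fintype.sum_option, Finset.mul_sum]
  simp only [κ, Option.elim, dist_self, mul_zero, zero_add, w]
  refine Finset.sum_le_sum fun i _ => mul_le_mul_of_nonneg_right ?_ dist_nonneg
  have h1 := Finset.single_le_sum (fun j _ => hw (some j)) (Finset.mem_univ i)
  have h2 : ∑ j, w (some j) = 1 - s := by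
    rw [Fintype.sum_option] at hw1
    simp only [w, Option.elim] at hw1 ⊢
    linarith
  rw [h2] at h1
  exact h1

/-- Mixtures depend continuously on their weights. -/
lemma WassersteinSpace.continuous_mixture {X ι : Type*} [TopologicalSpace X] [Fintype ι]
    {w : X → ι → ℝ} (hw : ∀ x i, 0 ≤ w x i) (hw1 : ∀ x, ∑ i, w x i = 1)
    (hwc : ∀ i, Continuous fun x => w x i) (μ : ι → WassersteinSpace Y) :
    Continuous fun x => mixture (w x) (hw x) (hw1 x) μ := by
  refine continuous_iff_continuousAt.2 fun x₀ => Metric.tendsto_nhds.2 fun ε hε => ?_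
  set ν := mixture (w x₀) (hw x₀) (hw1 x₀) μ
  set C := ∑ i, dist ν (μ i)
  have hC : 0 ≤ C := Finset.sum_nonneg fun _ _ => dist_nonneg
  obtain ⟨s, hs0, hs1, hsC⟩ : ∃ s : ℝ, 0 ≤ s ∧ s < 1 ∧ (1 - s) * C < ε := by
    have hlim : Tendsto (fun s : ℝ => (1 - s) * C) (𝓝[<] 1) (𝓝 0) := by
      have : Continuous fun s : ℝ => (1 - s) * C := by fun_prop
      simpa using (this.tendsto 1).mono_left nhdsWithin_le_nhds
    have h0 : ∀ᶠ s : ℝ in 𝓝[<] 1, 0 < s :=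
      nhdsWithin_le_nhds (lt_mem_nhds one_pos)
    obtain ⟨s, h1, h2, h3⟩ :=
      ((hlim.eventually (gt_mem_nhds hε)).and (h0.and self_mem_nhdsWithin)).exists
    exact ⟨s, h2.le, h3, h1⟩
  have hev : ∀ᶠ x in 𝓝 x₀, ∀ i, s * w x₀ i ≤ w x i := by
    refine eventually_all.2 fun i => ?_
    rcases (hw x₀ i).eq_or_lt with h | h
    · exact Eventually.of_forall fun x => by rw [← h, mul_zero]; exact hw x i
    · have hlt : s * w x₀ i < w x₀ i := by nlinarith
      filter_upwards [(hwc i).tendsto x₀ |>.eventually (lt_mem_nhds hlt)] with x hx using hx.le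
  filter_upwards [hev] with x hx
  rw [dist_comm]
  exact (dist_mixture_mixture_le (hw x₀) (hw1 x₀) (hw x) (hw1 x) μ hs0 hx).trans_lt hsC

end Mixtures

/-! ### Softmax weights concentrating on the nearest measures -/

section Softmax

variable {N : ℕ}

lemma softmax_nonneg (x : EuclideanSpace ℝ (Fin N)) (n : Fin N) : 0 ≤ softmax x n :=
  div_nonneg (Real.exp_pos _).le (Finset.sum_nonneg fun _ _ => (Real.exp_pos _).le)

lemma sum_exp_pos (hN : 1 ≤ N) (x : EuclideanSpace ℝ (Fin N)) : 0 < ∑ k, Real.exp (x k) :=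
  Finset.sum_pos (fun _ _ => Real.exp_pos _) ⟨⟨0, hN⟩, Finset.mem_univ _⟩

lemma sum_softmax (hN : 1 ≤ N) (x : EuclideanSpace ℝ (Fin N)) : ∑ n, softmax x n = 1 := by
  simp only [softmax, ← Finset.sum_div]
  exact div_self (sum_exp_pos hN x).ne'

lemma continuous_softmax (hN : 1 ≤ N) (n : Fin N) :
    Continuous fun x : EuclideanSpace ℝ (Fin N) => softmax x n :=
  Continuous.div (by fun_prop) (by fun_prop) fun x => (sum_exp_pos hN x).ne'

lemma softmax_le_exp_sub (x : EuclideanSpace ℝ (Fin N)) (n m : Fin N) :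
    softmax x n ≤ Real.exp (x n - x m) := by
  rw [softmax, Real.exp_sub]
  exact div_le_div_of_nonneg_left (Real.exp_pos _).le (Real.exp_pos _)
    (Finset.single_le_sum (f := fun k => Real.exp (x k)) (fun _ _ => (Real.exp_pos _).le)
      (Finset.mem_univ m))

/-- If the logits are within `1` of `-b * a n`, the softmax average of `a` is small as soon as one
`a m` is and `b` is large: an index with `a n > 2 δ` has weight at most `exp (2 - b * a n / 2)`. -/
lemma sum_softmax_mul_le {a : Fin N → ℝ} (x : EuclideanSpace ℝ (Fin N))
    {b δ : ℝ} (hb : 0 < b) (hx : ∀ n, |x n - -(b * a n)| ≤ 1) {m : Fin N} (ha : 0 ≤ a m)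
    (hm : a m ≤ δ) :
    ∑ n, softmax x n * a n ≤ 2 * δ + N * (2 * Real.exp 2 / b) := by
  have hterm : ∀ n, softmax x n * a n ≤ softmax x n * (2 * δ) + 2 * Real.exp 2 / b := fun n => by
    have hs := softmax_nonneg x n
    have hpos : 0 ≤ 2 * Real.exp 2 / b := by positivity
    rcases le_or_gt (a n) (2 * δ) with h | h
    · linarith [mul_le_mul_of_nonneg_left h hs]
    · have hδ : 0 ≤ δ := ha.trans hm
      have han : 0 < a n := by linarith
      have h1 : softmax x n ≤ Real.exp 2 * Real.exp (-(b * a n / 2)) := by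
        rw [← Real.exp_add]
        refine (softmax_le_exp_sub x n m).trans (Real.exp_le_exp.2 ?_)
        have hn := (abs_le.1 (hx n)).2
        have hm' := (abs_le.1 (hx m)).1
        nlinarith
      have h2 : a n * Real.exp (-(b * a n / 2)) ≤ 2 / b := by
        rw [Real.exp_neg, ← div_eq_mul_inv, div_le_div_iff₀ (Real.exp_pos _) hb]
        linarith [Real.add_one_le_exp (b * a n / 2)]
      calc softmax x n * a n ≤ Real.exp 2 * Real.exp (-(b * a n / 2)) * a n := by gcongr
        _ = Real.exp 2 * (a n * Real.exp (-(b * a n / 2))) := by ring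
        _ ≤ Real.exp 2 * (2 / b) := by gcongr
        _ = 2 * Real.exp 2 / b := by ring
        _ ≤ _ := by
          have : 0 ≤ softmax x n * (2 * δ) := by positivity
          linarith
  refine (Finset.sum_le_sum fun n _ => hterm n).trans ?_
  rw [Finset.sum_add_distrib, ← Finset.sum_mul, sum_softmax m.pos]
  simp

end Softmax

theorem mainTheorem2 {X Y : Type*}
    [MetricSpace X] [CompleteSpace X] [SeparableSpace X] [LocallyCompactSpace X]
    [MetricSpace Y] [CompleteSpace Y] [SeparableSpace Y] [MeasurableSpace Y] [BorelSpace Y]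
    {d : ℕ} (𝒟 : Set (WassersteinSpace Y)) (h𝒟_nonempty : 𝒟.Nonempty) (h𝒟 : Dense 𝒟)
    (φ : C(X, EuclideanSpace ℝ (Fin d))) (hφ : Function.Injective φ)
    (σ : ℝ → ℝ) (hσ : KidgerLyons σ) :
    -- `C(X, 𝒫₁(Y))` carries the compact-open topology: uniform convergence on compacts
    Dense (modelClass σ φ 𝒟) := by
  intro F
  refine ContinuousMap.mem_closure_of_forall_isCompact fun K hK ε hε => ?_
  have : CompactSpace K := isCompact_iff_compactSpace.1 hK
  have hδ : 0 < ε / 4 := by positivity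
  -- Finitely many members of `𝒟` form an `ε / 4`-net of `F(K)`; one more is added for `K = ∅`.
  obtain ⟨s, hs𝒟, hsfin, hcover⟩ := (hK.image F.continuous).elim_finite_subcover_image
    (b := 𝒟) (c := fun μ => Metric.ball μ (ε / 4)) (fun _ _ => Metric.isOpen_ball) fun ν _ => by
      obtain ⟨μ, hμ, hd⟩ := Metric.dense_iff.1 h𝒟 ν (ε / 4) hδ
      exact Set.mem_biUnion hd (Metric.mem_ball_comm.1 hμ)
  obtain ⟨μ₀, hμ₀⟩ := h𝒟_nonempty
  obtain ⟨N, μ, -, hμ⟩ := (hsfin.insert μ₀).fin_param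
  have hN : 1 ≤ N := by
    obtain ⟨n, -⟩ : μ₀ ∈ Set.range μ := hμ ▸ Set.mem_insert μ₀ s
    exact n.pos
  have hμ𝒟 : ∀ n, μ n ∈ 𝒟 := fun n => by
    rcases (hμ ▸ Set.mem_range_self n : μ n ∈ insert μ₀ s) with h | h
    · rwa [h]
    · exact hs𝒟 h
  have hnear : ∀ x ∈ K, ∃ m, dist (F x) (μ m) ≤ ε / 4 := fun x hx => by
    obtain ⟨ν, hν, hd⟩ := Set.mem_iUnion₂.1 (hcover (Set.mem_image_of_mem F hx))
    obtain ⟨m, rfl⟩ : ν ∈ Set.range μ := hμ ▸ Set.mem_insert_of_mem μ₀ hν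
    exact ⟨m, (Metric.mem_ball.1 hd).le⟩
  have hN0 : (0 : ℝ) < N := Nat.cast_pos.2 hN
  have he := Real.exp_pos 2
  -- The inverse temperature for which the error term of `sum_softmax_mul_le` is `ε / 4`.
  let b : ℝ := 8 * Real.exp 2 * N / ε
  have hb : 0 < b := by positivity
  obtain ⟨f, hf, hfc, hfx⟩ := exists_feedforwardNetworks_abs_sub_le (σ := ⟨σ, hσ.continuous⟩)
    (ψ := φ.restrict K) hσ.non_affine (hφ.comp Subtype.val_injective)
    (fun n => (⟨fun x => -(b * dist (F x) (μ n)), by fun_prop⟩ : C(K, ℝ))) one_pos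
  have hw := fun x : X => softmax_nonneg (f (φ x))
  have hw1 := fun x : X => sum_softmax hN (f (φ x))
  let G : C(X, WassersteinSpace Y) :=
    ⟨fun x => WassersteinSpace.mixture (softmax (f (φ x))) (hw x) (hw1 x) μ,
      WassersteinSpace.continuous_mixture hw hw1
        (fun n => (continuous_softmax hN n).comp (hfc.comp φ.continuous)) μ⟩
  refine ⟨G, ⟨N, hN, f, hf, μ, hμ𝒟, fun x => rfl⟩, fun x hx => ?_⟩
  obtain ⟨m, hm⟩ := hnear x hx
  calc dist (F x) (G x) ≤ ∑ n, softmax (f (φ x)) n * dist (F x) (μ n) :=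
        WassersteinSpace.dist_mixture_le _ _ (hw x) (hw1 x) μ
    _ ≤ 2 * (ε / 4) + N * (2 * Real.exp 2 / b) :=
        sum_softmax_mul_le _ hb (fun n => hfx ⟨x, hx⟩ n) dist_nonneg hm
    _ = 3 * ε / 4 := by
        simp only [b]
        field_simp
        ring
    _ < ε := by linarith
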